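/- **Model.** There are $n\ge 3f+1$ replicas, at most $f$ of them Byzantine and the others correct. Signatures, $(n,n-f)$ threshold signatures and hashes are ideal. Communication is partially synchronous: a message sent at time $s$ between correct replicas arrives by time $\max(s,\mathrm{GST})+\Delta$, $\Delta>0$. Local computation takes no time. The leader of view $v$ is the replica $L_v$ with index $v \bmod n$. The correct replicas run Streamlined HotStuff-1: * Blocks proposed in view $v$ carry a certificate $C_w$ of a lower view $w<v$; a certificate $C_b$ for a block $b$ aggregates signature shares on $b$ of $n-f$ distinct replicas (the genesis block, of view $0$, counts as certified). $C_b$ *extends* $C_{b'}$ if the view of $b$ is higher than that of $b'$ and $b'$ is among the blocks whose certificates $b$ carries directly or transitively; two certificates *conflict* if neither extends the other. * In view $v$ a correct leader $L_v$ waits for NewView messages for $v$ from $n-f$ replicas, and then until it can form from the received shares a certificate of view $v-1$, or has NewView messages from all $n$ replicas, or its share timer, set to $3\Delta$ after its starting time of $v$, fires. It then adopts the highest certificate among its own, those in these NewView messages and the one it formed, and broadcasts one block $B_v$ carrying it. * A correct replica $R$ in view $v$ that receives a block of $L_v$ carrying $C_w$, where $w$ is the view of the certified block $B_w$, (i) if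 $B_w$ carries a certificate of view $w-1$, commits (adds to its global ledger) the block of view $w-1$ so certified and all its ancestors; (ii) if $w=v-1$ and the predecessor of $B_w$ is committed, speculatively executes $B_w$ on its local ledger; (iii) if $w$ is at least the view of its highest known certificate, adopts $C_w$ as its highest known certificate and votes, i.e. sends to $L_{v+1}$ a NewView message for $v+1$ with $C_w$ and its share on the block, and otherwise sends a NewView message with its highest known certificate and no share; (iv) leaves view $v$. If its timer for $v$ expires first, it sends a NewView message for $v+1$ with its highest known certificate and no share, and leaves view $v$. After leaving $v$ it waits for the pacemaker to let it enter $v+1$. The pacemaker sets at each correct replica $R$ a starting time and a timer for each view. Let $v_s$ be the first synchronized view after GST; that is, for every view $v\ge v_s$, every correct replica enters $v$, after GST and less than $2\Delta$ after the starting time of $v$ at any correct replica; the timer of $v$ at a correct replica expires no earlier than $\tau$ after its starting time of $v$; and no correct replica times out of $v$ earlier than $2\Delta$ before the timer of $v$ at any correct replica expires. The timer length is sufficiently long: $\tau>6\Delta$. **Corollary.** Let $v\ge v_s$ and suppose that the leaders $L_v$ and $L_{v+1}$ of two consecutive views are correct. If $L_v$ proposes a block $B_v$ in view $v$, then $B_v$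 is eventually committed by all correct replicas, and no certificate of a view higher than $v$ that conflicts with the certificate of $B_v$ is ever formed. -/

import Mathlib

/-!
# Streamlined HotStuff-1 as a timed transition system

`n` replicas, at most `f` of them Byzantine, `3 f + 1 ≤ n`, partial synchrony (`GST`, `delta`),
ideal threshold signatures and hashes.
-/

namespace HotStuff1

/-- A block together with the chain of certified blocks below it: `node v txs j` is a block proposed
in view `v` with transactions `txs`, carrying a certificate for the block `j`.
A certificate is an `(n, n - f)` threshold signature on a block; such a signature is determined by
the block it certifies, so a certificate is written as that block, and its existence at a given
moment is `State.Certified` below. `genesis` is the block of view `0`, known to everybody. -/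
inductive Block (Tx : Type*) : Type _
  | genesis : Block Tx
  | node (view : ℕ) (txs : List Tx) (justify : Block Tx) : Block Tx

namespace Block

variable {Tx : Type*}

/-- The view in which the block was proposed. -/
def view : Block Tx → ℕ
  | genesis => 0
  | node v _ _ => v

/-- The block certified by the certificate that the block carries (its predecessor). -/
def justify : Block Tx → Block Tx
  | genesis => genesis
  | node _ _ j => j

/-- `b.Includes c`: the construction of `b` includes, directly or transitively, the certificate
of `c`. -/
def Includes : Block Tx → Block Tx → Prop
  | genesis, _ => False
  | node _ _ j, c => j = c ∨ j.Includes c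

/-- The certificate of `b` extends the certificate of `c`. -/
def Extends (b c : Block Tx) : Prop :=
  c.view < b.view ∧ b.Includes c

/-- Neither certificate extends the other. -/
def Conflicts (b c : Block Tx) : Prop :=
  ¬ b.Extends c ∧ ¬ c.Extends b

/-- All blocks up to and including `b`, oldest first. -/
def chain : Block Tx → List (Block Tx)
  | genesis => [genesis]
  | node v txs j => j.chain ++ [node v txs j]

end Block

/-- The system and its timing parameters. `start R v` and `timer R v` are the starting time of view
`v` and the expiry time of the timer for view `v` that the pacemaker sets at replica `R`; they are
arbitrary here, and become related to each other only by view synchronization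
(`Execution.SynchronizedFrom`). -/
structure System where
  /-- number of replicas -/
  n : ℕ
  /-- bound on the number of faulty replicas -/
  f : ℕ
  resilience : 3 * f + 1 ≤ n
  faulty : Finset (Fin n)
  card_faulty : faulty.card ≤ f
  /-- global stabilization time -/
  GST : ℝ
  /-- bound on transmission delays after `GST` -/
  delta : ℝ
  delta_pos : 0 < delta
  /-- length of the view timers -/
  tau : ℝ
  start : Fin n → ℕ → ℝ
  timer : Fin n → ℕ → ℝ

namespace System

/-- The replica is correct. -/
def Correct (S : System) (R : Fin S.n) : Prop := R ∉ S.faulty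

/-- Round-robin leader of view `v`. -/
def leader (S : System) (v : ℕ) : Fin S.n :=
  ⟨v % S.n, Nat.mod_lt v (lt_of_lt_of_le (Nat.succ_pos (3 * S.f)) S.resilience)⟩

end System

/-- Signed messages. `propose b` is the proposal of `b` (with its certificate for `b.justify`), signed
by the leader of view `b.view`. `newView src v c sh` is the NewView message of `src` for view `v`: it
carries a certificate for `c` and either a signature share of `src` on a block, or no share. -/
inductive Msg (S : System) (Tx : Type*) : Type _
  | propose (b : Block Tx) : Msg S Tx
  | newView (src : Fin S.n) (v : ℕ) (c : Block Tx) (share : Option (Block Tx)) : Msg S Tx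

namespace Msg

variable {S : System} {Tx : Type*}

/-- The replica that signs the message. -/
def sender : Msg S Tx → Fin S.n
  | propose b => S.leader b.view
  | newView src _ _ _ => src

/-- Proposals are broadcast; a NewView message for view `v` is addressed to the leader of `v`. -/
def AddressedTo : Msg S Tx → Fin S.n → Prop
  | propose _, _ => True
  | newView _ v _ _, R => R = S.leader v

end Msg

/-- Local state of a replica. -/
structure ReplicaState (S : System) (Tx : Type*) where
  /-- current view -/
  view : ℕ
  /-- the pacemaker has called `EnterView` for the current view -/
  entered : Prop
  /-- the replica, as the leader of the current view, has already proposed in it -/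
  proposed : Prop
  /-- highest known certificate -/
  highCert : Block Tx
  /-- messages received so far -/
  inbox : Set (Msg S Tx)
  globalLedger : List (Block Tx)
  localLedger : List (Block Tx)

/-- Global state: the current time, the local states (only those of correct replicas matter) and all
messages sent so far with their sending times. -/
structure State (S : System) (Tx : Type*) where
  now : ℝ
  loc : Fin S.n → ReplicaState S Tx
  sent : Set (Msg S Tx × ℝ)

namespace ReplicaState

variable {S : System} {Tx : Type*}

/-- The replicas from which a NewView message for the current view has been received. -/
def newViewSenders (r : ReplicaState S Tx) : Set (Fin S.n) :=
  {Q | ∃ c sh, Msg.newView Q r.view c sh ∈ r.inbox}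

/-- The NewView messages received for the current view contain shares of `n - f` distinct replicas
on the same proposal `b` of the preceding view, so that the certificate of `b` can be formed. -/
def Forms (r : ReplicaState S Tx) (b : Block Tx) : Prop :=
  b.view + 1 = r.view ∧
    S.n - S.f ≤ {Q : Fin S.n | ∃ c, Msg.newView Q r.view c (some b) ∈ r.inbox}.ncard

/-- The certificates known to the leader when it proposes: its own highest certificate, those in the
NewView messages received for the current view, and the one formed from their shares. -/
def Knows (r : ReplicaState S Tx) (c : Block Tx) : Prop :=
  c = r.highCert ∨ (∃ Q sh, Msg.newView Q r.view c sh ∈ r.inbox) ∨ r.Forms c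

/-- The condition under which `R`, with local state `r`, proposes at time `t`: it leads its current
view, has not proposed yet, has received `n - f` NewView messages, and has formed the certificate of
the preceding view, or has received `n` NewView messages, or its share timer (`3 delta` after the
starting time of the view) has fired. -/
def CanPropose (R : Fin S.n) (r : ReplicaState S Tx) (t : ℝ) : Prop :=
  r.entered ∧ R = S.leader r.view ∧ ¬ r.proposed ∧
    S.n - S.f ≤ r.newViewSenders.ncard ∧
    ((∃ b, r.Forms b) ∨ S.n ≤ r.newViewSenders.ncard ∨ S.start R r.view + 3 * S.delta ≤ t)

/-- A proposal `b` for the current view has been received and can be handled. -/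
def CanHandle (r : ReplicaState S Tx) (b : Block Tx) : Prop :=
  r.entered ∧ b.view = r.view ∧ Msg.propose b ∈ r.inbox

/-- The timer of the current view has expired. -/
def CanTimeout (R : Fin S.n) (r : ReplicaState S Tx) (t : ℝ) : Prop :=
  r.entered ∧ S.timer R r.view ≤ t

/-- `exitView`: move on to the next view and wait for the pacemaker to enter it. -/
def exitView (r : ReplicaState S Tx) : ReplicaState S Tx :=
  { r with view := r.view + 1, entered := False, proposed := False }

open Classical in
/-- Commit rule: a certificate of `c`, of view `w`, that extends a certificate of view `w - 1`
(necessarily that of `c.justify`) commits all blocks up to and including that of view `w - 1`: those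
not yet in the global ledger are executed and appended. -/
noncomputable def commit (r : ReplicaState S Tx) (c : Block Tx) : ReplicaState S Tx :=
  if c.justify.view + 1 = c.view then
    { r with globalLedger :=
        r.globalLedger ++ c.justify.chain.filter (fun b => decide (b ∉ r.globalLedger)) }
  else r

open Classical in
/-- Speculation: if `c` is of the preceding view (No-Gap rule) and the predecessor of `c` is in the
global ledger (Prefix Speculation rule), then the local ledger is rolled back to the common ancestor
if it conflicts with `c`, and `c` is executed on it, so that it holds the chain ending in `c`. -/
noncomputable def speculate (r : ReplicaState S Tx) (c : Block Tx) : ReplicaState S Tx :=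
  if c.view + 1 = r.view ∧ c.justify ∈ r.globalLedger then
    { r with localLedger := c.chain }
  else r

/-- The replica votes for the proposal `b`: the certificate in `b` is at least as high as the highest
certificate that the replica knows. -/
def Votes (r : ReplicaState S Tx) (b : Block Tx) : Prop :=
  r.highCert.view ≤ b.justify.view

open Classical in
/-- Local state after handling the proposal `b` of the current view. -/
noncomputable def afterProposal (r : ReplicaState S Tx) (b : Block Tx) : ReplicaState S Tx :=
  let r' := (r.commit b.justify).speculate b.justify
  (if r.Votes b then { r' with highCert := b.justify } else r').exitView

open Classical in
/-- The NewView message sent on handling the proposal `b`: with a share on `b` if the replica votes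
for it, and otherwise without a share, carrying the highest known certificate. -/
noncomputable def proposalReply (R : Fin S.n) (r : ReplicaState S Tx) (b : Block Tx) : Msg S Tx :=
  if r.Votes b then .newView R (r.view + 1) b.justify (some b)
  else .newView R (r.view + 1) r.highCert none

end ReplicaState

namespace State

variable {S : System} {Tx : Type*}

/-- A certificate for `b` can exist: `n - f` distinct replicas have signed a share on `b`. Faulty
replicas may sign anything; a correct replica has signed exactly the shares that it has sent. -/
def Certified (s : State S Tx) (b : Block Tx) : Prop :=
  b = .genesis ∨
    S.n - S.f ≤ {R : Fin S.n | R ∈ S.faulty ∨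
      ∃ v c t, ((Msg.newView R v c (some b), t) : Msg S Tx × ℝ) ∈ s.sent}.ncard

/-- Well-formed messages (others are ignored by correct replicas): the certificate is valid and of a
lower view than the message. -/
def WellFormed (s : State S Tx) : Msg S Tx → Prop
  | .propose b => b.justify.view < b.view ∧ s.Certified b.justify
  | .newView _ v c _ => c.view < v ∧ s.Certified c

/-- Initial state: everybody is about to enter view `1`, knows only the genesis block, and the NewView
messages for view `1` of the correct replicas are under way. -/
def initial (S : System) (Tx : Type*) : State S Tx where
  now := 0
  loc := fun _ =>
    { view := 1
      entered := False
      proposed := False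
      highCert := .genesis
      inbox := ∅
      globalLedger := [.genesis]
      localLedger := [.genesis] }
  sent := {p | ∃ R, S.Correct R ∧ p = (.newView R 1 .genesis none, 0)}

/-- Replace the local state of `R`. -/
def setLoc (s : State S Tx) (R : Fin S.n) (r : ReplicaState S Tx) : State S Tx :=
  { s with loc := Function.update s.loc R r }

/-- Send a message now. -/
def send (s : State S Tx) (m : Msg S Tx) : State S Tx :=
  { s with sent := insert (m, s.now) s.sent }

/-- Time may pass up to `t`: until then no correct replica has an enabled protocol action (local
computation takes no time), and every message between correct replicas that was sent at time `u` is
received by time `max u GST + delta`. -/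
def CanPassTo (s : State S Tx) (t : ℝ) : Prop :=
  (∀ R, S.Correct R → ∀ u, s.now ≤ u → u < t →
      ¬ (s.loc R).CanPropose R u ∧ (∀ b, ¬ (s.loc R).CanHandle b) ∧ ¬ (s.loc R).CanTimeout R u) ∧
  (∀ m u, (m, u) ∈ s.sent → S.Correct m.sender → ∀ R, S.Correct R → m.AddressedTo R →
      m ∉ (s.loc R).inbox → t ≤ max u S.GST + S.delta)

end State

/-- Actions: the pacemaker makes `R` enter its current view; a message is delivered to `R`; the
leader `R` proposes a block with transactions `txs` on its highest certificate `c`; `R` handles a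
proposal; `R` times out; a faulty replica sends a message; time passes. -/
inductive Action (S : System) (Tx : Type*) : Type _
  | enter (R : Fin S.n) : Action S Tx
  | deliver (R : Fin S.n) (m : Msg S Tx) : Action S Tx
  | propose (R : Fin S.n) (txs : List Tx) (c : Block Tx) : Action S Tx
  | handle (R : Fin S.n) (b : Block Tx) : Action S Tx
  | timeout (R : Fin S.n) : Action S Tx
  | byzantine (m : Msg S Tx) : Action S Tx
  | pass (t : ℝ) : Action S Tx

/-- The transition relation of the protocol. Messages that have been sent may be delivered to anybody,
in any order and any number of times. -/
def Step {S : System} {Tx : Type*} (s : State S Tx) : Action S Tx → State S Tx → Prop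
  | .enter R, s' =>
      S.Correct R ∧ ¬ (s.loc R).entered ∧ s' = s.setLoc R { s.loc R with entered := True }
  | .deliver R m, s' =>
      S.Correct R ∧ (∃ u, (m, u) ∈ s.sent) ∧
        s' = s.setLoc R { s.loc R with inbox := insert m (s.loc R).inbox }
  | .propose R txs c, s' =>
      S.Correct R ∧ (s.loc R).CanPropose R s.now ∧
        (s.loc R).Knows c ∧ (∀ c', (s.loc R).Knows c' → c'.view ≤ c.view) ∧
        s' = (s.setLoc R { s.loc R with highCert := c, proposed := True }).send
          (.propose (.node (s.loc R).view txs c))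
  | .handle R b, s' =>
      S.Correct R ∧ (s.loc R).CanHandle b ∧
        s' = (s.setLoc R ((s.loc R).afterProposal b)).send ((s.loc R).proposalReply R b)
  | .timeout R, s' =>
      S.Correct R ∧ (s.loc R).CanTimeout R s.now ∧
        s' = (s.setLoc R (s.loc R).exitView).send
          (.newView R ((s.loc R).view + 1) (s.loc R).highCert none)
  | .byzantine m, s' => m.sender ∈ S.faulty ∧ s.WellFormed m ∧ s' = s.send m
  | .pass t, s' => s.now < t ∧ s.CanPassTo t ∧ s' = { s with now := t }

/-- An execution: an infinite run from the initial state along which time diverges. -/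
structure Execution (S : System) (Tx : Type*) where
  state : ℕ → State S Tx
  act : ℕ → Action S Tx
  state_zero : state 0 = State.initial S Tx
  step : ∀ k, Step (state k) (act k) (state (k + 1))
  time_diverges : ∀ T : ℝ, ∃ k, T < (state k).now

namespace Execution

variable {S : System} {Tx : Type*}

/-- In step `k`, replica `R` enters view `v`. -/
def EntersAt (E : Execution S Tx) (k : ℕ) (R : Fin S.n) (v : ℕ) : Prop :=
  E.act k = .enter R ∧ ((E.state k).loc R).view = v

/-- In step `k`, replica `R` times out of view `v`. -/
def TimesOutAt (E : Execution S Tx) (k : ℕ) (R : Fin S.n) (v : ℕ) : Prop :=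
  E.act k = .timeout R ∧ ((E.state k).loc R).view = v

/-- The replica `R` proposes the block `b` in view `v`, following the protocol. -/
def Proposes (E : Execution S Tx) (R : Fin S.n) (v : ℕ) (b : Block Tx) : Prop :=
  ∃ k txs c, E.act k = .propose R txs c ∧ ((E.state k).loc R).view = v ∧ b = .node v txs c

/-- The views from `vs` on are synchronized after `GST`. For every view `v ≥ vs`: every correct
replica enters `v`, after `GST`, and less than `2 delta` after the starting time of `v` at any correct
replica; view timers run for at least `tau` from the starting time of the view; and no correct replica
times out of `v` earlier than `2 delta` before the timer of `v` of any correct replica expires. -/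
def SynchronizedFrom (E : Execution S Tx) (vs : ℕ) : Prop :=
  ∀ v, vs ≤ v →
    (∀ R, S.Correct R → ∃ k, E.EntersAt k R v ∧ S.GST ≤ (E.state k).now ∧
      ∀ R', S.Correct R' → (E.state k).now < S.start R' v + 2 * S.delta) ∧
    (∀ R, S.Correct R → S.start R v + S.tau ≤ S.timer R v) ∧
    (∀ k R R', S.Correct R → S.Correct R' → E.TimesOutAt k R' v →
      S.timer R v - 2 * S.delta ≤ (E.state k).now)

/-- `R` eventually commits `b`: from some step on, `b` is in the global ledger of `R`. -/
def EventuallyCommits (E : Execution S Tx) (R : Fin S.n) (b : Block Tx) : Prop :=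
  ∃ K, ∀ k, K ≤ k → b ∈ ((E.state k).loc R).globalLedger

/-- Some certificate for a block of a view above `v` that conflicts with `b` is formed at some point
of the execution. -/
def ConflictingCertificateAbove (E : Execution S Tx) (v : ℕ) (b : Block Tx) : Prop :=
  ∃ k b', (E.state k).Certified b' ∧ v < b'.view ∧ b'.Conflicts b

end Execution

end HotStuff1

/-! Safety and liveness both rest on one fact: if the leaders of `w` and `w + 1` are correct and the
views are synchronized, every certificate of a view above `w` is built on the block `B` proposed in
`w`.

The timing budget makes synchronized views with correct leaders productive. Within `2Δ` of the
leader's starting time all correct replicas have entered, within `3Δ` the leader holds all their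
NewView messages and has proposed, and within `4Δ` the proposal has reached everyone, while `τ > 6Δ`
excludes timeouts up to then (`leader_proposes`, `handles`). The leader's certificate is at least as
high as any that a correct replica brings into the view, so all correct replicas vote (`all_vote`).
The next correct leader therefore obtains a certificate of view `w`, which can only certify `B`, and
extends it (`justify_eq`).

On voting in view `w + 1` each correct replica adopts the certificate of `B` and never again votes
for a block carrying a lower one. Every quorum contains a correct replica, so induction on the view
shows that all higher certificates extend that of `B` (`includes_of_certified`). This rules out
conflicts.

For liveness, since `n > 3f`, three consecutive correct leaders occur after any view. They produce
three directly linked blocks of consecutive views, so the first is committed with its ancestors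
(`commits`). It is certified in a view above that of `B`, hence `B` is among these ancestors. -/

namespace HotStuff1

variable {S : System} {Tx : Type*}

/-! ### Chains of blocks, quorums and the leader schedule. -/

namespace Block

theorem self_mem_chain (b : Block Tx) : b ∈ b.chain := by
  cases b <;> simp [chain]

theorem Includes.mem_chain {b c : Block Tx} (h : b.Includes c) : c ∈ b.chain := by
  induction b with
  | genesis => exact h.elim
  | node v txs j ih =>
    rcases h with rfl | h
    · simp [chain, self_mem_chain]
    · simp [chain, ih h]

theorem includes_justify {b : Block Tx} (h : 0 < b.view) : b.Includes b.justify := by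
  cases b with
  | genesis => exact absurd h (lt_irrefl _)
  | node v txs j => exact Or.inl rfl

theorem Includes.of_justify {b c : Block Tx} (h : b.justify.Includes c) : b.Includes c := by
  cases b with
  | genesis => exact h
  | node v txs j => exact Or.inr h

end Block

namespace System

theorem card_correct (S : System) : S.n - S.f ≤ {R : Fin S.n | S.Correct R}.ncard := by
  have h : {R : Fin S.n | S.Correct R} = ((S.faultyᶜ : Finset (Fin S.n)) : Set (Fin S.n)) := by
    ext R
    simp [Correct]
  rw [h, Set.ncard_coe_finset, Finset.card_compl, Fintype.card_fin]
  have := S.card_faulty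
  omega

/-- Every quorum contains a correct replica. -/
theorem exists_correct_mem_of_quorum (S : System) {A : Set (Fin S.n)}
    (h : S.n - S.f ≤ A.ncard) : ∃ R ∈ A, S.Correct R := by
  by_contra! hA
  have hsub : A ⊆ (S.faulty : Set (Fin S.n)) := fun R hR => by
    simpa [Correct] using hA R hR
  have h1 := Set.ncard_le_ncard hsub (Set.toFinite _)
  rw [Set.ncard_coe_finset] at h1
  have := S.card_faulty
  have := S.resilience
  omega

/-- The round-robin schedule has three consecutive correct leaders after any view. -/
theorem exists_three_correct_leaders (S : System) (v : ℕ) :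
    ∃ u, v < u ∧ S.Correct (S.leader u) ∧ S.Correct (S.leader (u + 1)) ∧
      S.Correct (S.leader (u + 2)) := by
  by_contra! h
  have key : ∀ i : Fin S.n, ∃ j : Fin 3, S.leader (v + 1 + i + j) ∈ S.faulty := by
    intro i
    by_contra! hi
    exact h (v + 1 + i) (by omega) (hi 0) (hi 1) (hi 2)
  choose j hj using key
  -- The `n` windows of three views starting at `v + 1 + i` each have a faulty leader. Its offset
  -- and identity determine `i` modulo `n`, so `n ≤ 3f` would follow.
  have hinj : Function.Injective
      (fun i => (j i, (⟨S.leader (v + 1 + i + j i), hj i⟩ : S.faulty))) := by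
    intro a b hab
    simp only [Prod.mk.injEq, Subtype.mk.injEq, leader, Fin.mk.injEq] at hab
    obtain ⟨h1, h2⟩ := hab
    rw [h1] at h2
    have h3 : (v + 1 + a + j b) ≡ (v + 1 + b + j b) [MOD S.n] := h2
    have h4 : (a : ℕ) ≡ b [MOD S.n] :=
      Nat.ModEq.add_left_cancel' (v + 1) (Nat.ModEq.add_right_cancel' _ h3)
    exact Fin.ext (Nat.ModEq.eq_of_lt_of_lt h4 a.2 b.2)
  have hcard := Fintype.card_le_of_injective _ hinj
  simp only [Fintype.card_fin, Fintype.card_prod, Fintype.card_coe] at hcard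
  have := S.card_faulty
  have := S.resilience
  omega

end System

/-! ### Certificates and the effect of a single transition. -/

namespace State

theorem Certified.mono {s s' : State S Tx} (h : s.sent ⊆ s'.sent) {b : Block Tx}
    (hb : s.Certified b) : s'.Certified b := by
  refine hb.imp_right fun hq => hq.trans (Set.ncard_le_ncard ?_ (Set.toFinite _))
  rintro R (hR | ⟨v, c, t, hm⟩)
  · exact Or.inl hR
  · exact Or.inr ⟨v, c, t, h hm⟩

theorem WellFormed.mono {s s' : State S Tx} (h : s.sent ⊆ s'.sent) {m : Msg S Tx}
    (hm : s.WellFormed m) : s'.WellFormed m := by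
  cases m with
  | propose b => exact ⟨hm.1, hm.2.mono h⟩
  | newView Q v c sh => exact ⟨hm.1, hm.2.mono h⟩

theorem Certified.exists_share {s : State S Tx} {b : Block Tx} (hb : s.Certified b)
    (hv : 0 < b.view) : ∃ R, S.Correct R ∧ ∃ v c t, (Msg.newView R v c (some b), t) ∈ s.sent := by
  rcases hb with rfl | hb
  · exact absurd hv (lt_irrefl _)
  · obtain ⟨R, hR, hc⟩ := S.exists_correct_mem_of_quorum hb
    exact ⟨R, hc, hR.resolve_left hc⟩

end State

namespace Step

variable {s s' : State S Tx} {a : Action S Tx}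

theorem now_le (h : Step s a s') : s.now ≤ s'.now := by
  cases a with
  | enter R => obtain ⟨-, -, rfl⟩ := h; exact le_rfl
  | deliver R m => obtain ⟨-, -, rfl⟩ := h; exact le_rfl
  | propose R txs c => obtain ⟨-, -, -, -, rfl⟩ := h; exact le_rfl
  | handle R b => obtain ⟨-, -, rfl⟩ := h; exact le_rfl
  | timeout R => obtain ⟨-, -, rfl⟩ := h; exact le_rfl
  | byzantine m => obtain ⟨-, -, rfl⟩ := h; exact le_rfl
  | pass t => obtain ⟨ht, -, rfl⟩ := h; exact ht.le

theorem sent_cases (h : Step s a s') : s'.sent = s.sent ∨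
    ∃ m, s'.sent = insert (m, s.now) s.sent ∧
      ((∃ R txs c, a = .propose R txs c ∧ m = .propose (.node (s.loc R).view txs c)) ∨
       (∃ R b, a = .handle R b ∧ m = (s.loc R).proposalReply R b) ∨
       (∃ R, a = .timeout R ∧ m = .newView R ((s.loc R).view + 1) (s.loc R).highCert none) ∨
       (a = .byzantine m ∧ m.sender ∈ S.faulty)) := by
  cases a with
  | enter R => obtain ⟨-, -, rfl⟩ := h; exact Or.inl rfl
  | deliver R m => obtain ⟨-, -, rfl⟩ := h; exact Or.inl rfl
  | propose R txs c =>
    obtain ⟨-, -, -, -, rfl⟩ := h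
    exact Or.inr ⟨_, rfl, Or.inl ⟨R, txs, c, rfl, rfl⟩⟩
  | handle R b =>
    obtain ⟨-, -, rfl⟩ := h
    exact Or.inr ⟨_, rfl, Or.inr (Or.inl ⟨R, b, rfl, rfl⟩)⟩
  | timeout R =>
    obtain ⟨-, -, rfl⟩ := h
    exact Or.inr ⟨_, rfl, Or.inr (Or.inr (Or.inl ⟨R, rfl, rfl⟩))⟩
  | byzantine m =>
    obtain ⟨h1, -, rfl⟩ := h
    exact Or.inr ⟨_, rfl, Or.inr (Or.inr (Or.inr ⟨rfl, h1⟩))⟩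
  | pass t => obtain ⟨ht, -, rfl⟩ := h; exact Or.inl rfl

theorem sent_subset (h : Step s a s') : s.sent ⊆ s'.sent := by
  rcases h.sent_cases with h | ⟨m, h, -⟩ <;> rw [h]
  exact Set.subset_insert _ _

theorem loc_cases (h : Step s a s') (R : Fin S.n) : s'.loc R = s.loc R ∨
    (a = .enter R ∧ s'.loc R = { s.loc R with entered := True }) ∨
    (∃ m, a = .deliver R m ∧ s'.loc R = { s.loc R with inbox := insert m (s.loc R).inbox }) ∨
    (∃ txs c, a = .propose R txs c ∧ s'.loc R = { s.loc R with highCert := c, proposed := True }) ∨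
    (∃ b, a = .handle R b ∧ s'.loc R = (s.loc R).afterProposal b) ∨
    (a = .timeout R ∧ s'.loc R = (s.loc R).exitView) := by
  cases a with
  | enter Q =>
    obtain ⟨-, -, rfl⟩ := h
    rcases eq_or_ne R Q with rfl | hne
    · exact Or.inr (Or.inl ⟨rfl, by simp [State.setLoc]⟩)
    · exact Or.inl (by simp [State.setLoc, hne])
  | deliver Q m =>
    obtain ⟨-, -, rfl⟩ := h
    rcases eq_or_ne R Q with rfl | hne
    · exact Or.inr (Or.inr (Or.inl ⟨m, rfl, by simp [State.setLoc]⟩))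
    · exact Or.inl (by simp [State.setLoc, hne])
  | propose Q txs c =>
    obtain ⟨-, -, -, -, rfl⟩ := h
    rcases eq_or_ne R Q with rfl | hne
    · exact Or.inr (Or.inr (Or.inr (Or.inl ⟨txs, c, rfl, by simp [State.setLoc, State.send]⟩)))
    · exact Or.inl (by simp [State.setLoc, State.send, hne])
  | handle Q b =>
    obtain ⟨-, -, rfl⟩ := h
    rcases eq_or_ne R Q with rfl | hne
    · exact Or.inr (Or.inr (Or.inr (Or.inr (Or.inl ⟨b, rfl, by
        simp [State.setLoc, State.send]⟩))))
    · exact Or.inl (by simp [State.setLoc, State.send, hne])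
  | timeout Q =>
    obtain ⟨-, -, rfl⟩ := h
    rcases eq_or_ne R Q with rfl | hne
    · exact Or.inr (Or.inr (Or.inr (Or.inr (Or.inr ⟨rfl, by simp [State.setLoc, State.send]⟩))))
    · exact Or.inl (by simp [State.setLoc, State.send, hne])
  | byzantine m => obtain ⟨-, -, rfl⟩ := h; exact Or.inl rfl
  | pass t => obtain ⟨-, -, rfl⟩ := h; exact Or.inl rfl

end Step

namespace ReplicaState

theorem commit_speculate_fields (r : ReplicaState S Tx) (c : Block Tx) :
    ((r.commit c).speculate c).view = r.view ∧
    ((r.commit c).speculate c).highCert = r.highCert ∧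
    ((r.commit c).speculate c).inbox = r.inbox ∧
    ((r.commit c).speculate c).globalLedger = (r.commit c).globalLedger := by
  have h1 : (r.commit c).view = r.view ∧ (r.commit c).highCert = r.highCert ∧
      (r.commit c).inbox = r.inbox := by
    unfold commit
    split_ifs <;> exact ⟨rfl, rfl, rfl⟩
  unfold speculate
  split_ifs <;> exact ⟨h1.1, h1.2.1, h1.2.2, rfl⟩

open Classical in
theorem afterProposal_fields (r : ReplicaState S Tx) (b : Block Tx) :
    (r.afterProposal b).view = r.view + 1 ∧
    (r.afterProposal b).highCert = (if r.Votes b then b.justify else r.highCert) ∧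
    (r.afterProposal b).inbox = r.inbox ∧
    (r.afterProposal b).globalLedger = (r.commit b.justify).globalLedger := by
  obtain ⟨h1, h2, h3, h4⟩ := commit_speculate_fields r b.justify
  unfold afterProposal exitView
  dsimp only
  split_ifs
  · exact ⟨by rw [h1], rfl, h3, h4⟩
  · exact ⟨by rw [h1], h2, h3, h4⟩

@[simp] theorem afterProposal_view (r : ReplicaState S Tx) (b : Block Tx) :
    (r.afterProposal b).view = r.view + 1 := (afterProposal_fields r b).1

@[simp] theorem afterProposal_proposed (r : ReplicaState S Tx) (b : Block Tx) :
    (r.afterProposal b).proposed = False := rfl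

@[simp] theorem afterProposal_inbox (r : ReplicaState S Tx) (b : Block Tx) :
    (r.afterProposal b).inbox = r.inbox := (afterProposal_fields r b).2.2.1

open Classical in
theorem afterProposal_highCert (r : ReplicaState S Tx) (b : Block Tx) :
    (r.afterProposal b).highCert = if r.Votes b then b.justify else r.highCert :=
  (afterProposal_fields r b).2.1

theorem afterProposal_globalLedger (r : ReplicaState S Tx) (b : Block Tx) :
    (r.afterProposal b).globalLedger = (r.commit b.justify).globalLedger :=
  (afterProposal_fields r b).2.2.2

theorem globalLedger_subset_commit (r : ReplicaState S Tx) (c : Block Tx) :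
    r.globalLedger ⊆ (r.commit c).globalLedger := by
  unfold commit
  split_ifs
  · exact List.subset_append_left _ _
  · exact List.Subset.refl _

theorem mem_commit (r : ReplicaState S Tx) {b c : Block Tx} (h : c.justify.view + 1 = c.view)
    (hb : b ∈ c.justify.chain) : b ∈ (r.commit c).globalLedger := by
  classical
  unfold commit
  rw [if_pos h]
  by_cases hg : b ∈ r.globalLedger <;> simp [hb, hg]

/-- Vote or not, the reply carries the highest certificate held after handling. This uniform shape
lets handling and timing out share the lemma `LocalInv.exit`. -/
theorem proposalReply_eq (R : Fin S.n) (r : ReplicaState S Tx) (b : Block Tx) :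
    ∃ sh, r.proposalReply R b = .newView R (r.view + 1) (r.afterProposal b).highCert sh ∧
      ∀ b', sh = some b' → b' = b ∧ r.Votes b := by
  unfold proposalReply
  rw [afterProposal_highCert]
  split_ifs with h
  · exact ⟨_, rfl, by rintro _ ⟨⟩; exact ⟨rfl, h⟩⟩
  · exact ⟨_, rfl, by rintro _ ⟨⟩⟩

end ReplicaState

namespace Step

variable {s s' : State S Tx} {a : Action S Tx}

theorem view_le (h : Step s a s') (R : Fin S.n) : (s.loc R).view ≤ (s'.loc R).view := by
  rcases h.loc_cases R with h | ⟨-, h⟩ | ⟨m, -, h⟩ | ⟨txs, c, -, h⟩ | ⟨b, -, h⟩ | ⟨-, h⟩ <;>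
    simp [h, ReplicaState.exitView]

theorem highCert_view_le (h : Step s a s') (R : Fin S.n) :
    (s.loc R).highCert.view ≤ (s'.loc R).highCert.view := by
  classical
  rcases h.loc_cases R with h' | ⟨-, h'⟩ | ⟨m, -, h'⟩ | ⟨txs, c, rfl, h'⟩ | ⟨b, -, h'⟩ | ⟨-, h'⟩ <;>
    rw [h']
  · exact h.2.2.2.1 _ (Or.inl rfl)
  · rw [ReplicaState.afterProposal_highCert]
    split_ifs with hv
    · exact hv
    · exact le_rfl
  · exact le_rfl

theorem globalLedger_subset (h : Step s a s') (R : Fin S.n) :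
    (s.loc R).globalLedger ⊆ (s'.loc R).globalLedger := by
  rcases h.loc_cases R with h | ⟨-, h⟩ | ⟨m, -, h⟩ | ⟨txs, c, -, h⟩ | ⟨b, -, h⟩ | ⟨-, h⟩ <;> rw [h]
  case inr.inr.inr.inr.inl =>
    rw [ReplicaState.afterProposal_globalLedger]
    exact ReplicaState.globalLedger_subset_commit _ _
  all_goals exact List.Subset.refl _

end Step

/-! ### The invariant and its preservation. -/

/-- What holds between the messages sent so far and the local state `r` of a correct replica `R`. -/
structure LocalInv (M : Set (Msg S Tx × ℝ)) (R : Fin S.n) (r : ReplicaState S Tx) : Prop where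
  view_pos : 0 < r.view
  inbox_sent : ∀ m ∈ r.inbox, ∃ u, (m, u) ∈ M
  newView_exists : ∃ c sh u, (Msg.newView R r.view c sh, u) ∈ M
  newView_le : ∀ w c sh u, (Msg.newView R w c sh, u) ∈ M → w ≤ r.view
  newView_unique : ∀ w c sh u c' sh' u', (Msg.newView R w c sh, u) ∈ M →
    (Msg.newView R w c' sh', u') ∈ M → c = c' ∧ sh = sh'
  -- The second alternative is for a leader, which may raise its highest certificate within the view
  -- by proposing.
  newView_high : ∀ c sh u, (Msg.newView R r.view c sh, u) ∈ M → c = r.highCert ∨ r.proposed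
  high_lt : r.highCert.view < r.view
  proposed_sent : r.proposed → ∃ b u, (Msg.propose b, u) ∈ M ∧ b.view = r.view ∧
    b.justify = r.highCert ∧ S.leader r.view = R
  propose_le : ∀ b u, (Msg.propose b, u) ∈ M → S.leader b.view = R →
    b.view < r.view ∨ (b.view = r.view ∧ r.proposed)
  propose_unique : ∀ b u b' u', (Msg.propose b, u) ∈ M → (Msg.propose b', u') ∈ M →
    S.leader b.view = R → b.view = b'.view → b = b'

namespace LocalInv

variable {M : Set (Msg S Tx × ℝ)} {R : Fin S.n} {r r' : ReplicaState S Tx}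

/-- Signatures are unforgeable: each clause either restricts only messages signed by `R` or survives
enlarging `M`. -/
theorem insert_of_sender_ne (h : LocalInv M R r) {m : Msg S Tx} (hm : m.sender ≠ R) (t : ℝ) :
    LocalInv (insert (m, t) M) R r := by
  have hN : ∀ {w c sh u}, (Msg.newView R w c sh, u) ∈ insert (m, t) M →
      (Msg.newView R w c sh, u) ∈ M := by
    rintro w c sh u (heq | h')
    · obtain ⟨rfl, -⟩ := Prod.mk.inj heq
      exact absurd rfl hm
    · exact h'
  have hP : ∀ {b u}, S.leader b.view = R → (Msg.propose b, u) ∈ insert (m, t) M →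
      (Msg.propose b, u) ∈ M := by
    rintro b u hb (heq | h')
    · obtain ⟨rfl, -⟩ := Prod.mk.inj heq
      exact absurd hb hm
    · exact h'
  refine ⟨h.view_pos, fun m' hm' => ?_, ?_, fun w c sh u hmem => h.newView_le w c sh u (hN hmem),
    fun w c sh u c' sh' u' h1 h2 => h.newView_unique w c sh u c' sh' u' (hN h1) (hN h2),
    fun c sh u hmem => h.newView_high c sh u (hN hmem), h.high_lt, fun hp => ?_,
    fun b u hb hl => h.propose_le b u (hP hl hb) hl,
    fun b u b' u' h1 h2 hl hv => h.propose_unique b u b' u' (hP hl h1) (hP (hv ▸ hl) h2) hl hv⟩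
  · obtain ⟨u, hu⟩ := h.inbox_sent m' hm'
    exact ⟨u, Or.inr hu⟩
  · obtain ⟨c, sh, u, hu⟩ := h.newView_exists
    exact ⟨c, sh, u, Or.inr hu⟩
  · obtain ⟨b, u, hb, h'⟩ := h.proposed_sent hp
    exact ⟨b, u, Or.inr hb, h'⟩

theorem enter (h : LocalInv M R r) : LocalInv M R { r with entered := True } :=
  ⟨h.view_pos, h.inbox_sent, h.newView_exists, h.newView_le, h.newView_unique, h.newView_high,
    h.high_lt, h.proposed_sent, h.propose_le, h.propose_unique⟩

theorem deliver (h : LocalInv M R r) {m : Msg S Tx} (hm : ∃ u, (m, u) ∈ M) :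
    LocalInv M R { r with inbox := insert m r.inbox } :=
  ⟨h.view_pos, by rintro m' (rfl | hm'); exacts [hm, h.inbox_sent m' hm'], h.newView_exists,
    h.newView_le, h.newView_unique, h.newView_high,
    h.high_lt, h.proposed_sent, h.propose_le, h.propose_unique⟩

/-- By `propose_le`, a leader that has not yet proposed has signed proposals of lower views only, so
the new one cannot clash with them. -/
theorem propose (h : LocalInv M R r) {t : ℝ} (hR : R = S.leader r.view) (hp : ¬ r.proposed)
    (txs : List Tx) {c : Block Tx} (hc : c.view < r.view) :
    LocalInv (insert (Msg.propose (.node r.view txs c), t) M) R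
      { r with highCert := c, proposed := True } := by
  have hN : ∀ {w c' sh u}, (Msg.newView R w c' sh, u) ∈
      insert (Msg.propose (.node r.view txs c), t) M → (Msg.newView R w c' sh, u) ∈ M := by
    rintro w c' sh u (heq | h')
    · exact nomatch (Prod.mk.inj heq).1
    · exact h'
  have hnew : ∀ b u, (Msg.propose b, u) ∈ M → S.leader b.view = R → b.view ≠ r.view := by
    intro b u hb hl hv
    rcases h.propose_le b u hb hl with h' | h'
    · exact absurd hv h'.ne
    · exact hp h'.2
  refine ⟨h.view_pos, fun m' hm' => ?_, ?_, fun w c sh u hmem => h.newView_le w c sh u (hN hmem),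
    fun w c sh u c' sh' u' h1 h2 => h.newView_unique w c sh u c' sh' u' (hN h1) (hN h2),
    fun _ _ _ _ => Or.inr trivial, hc, fun _ => ⟨_, t, Or.inl rfl, rfl, rfl, hR.symm⟩, ?_, ?_⟩
  · obtain ⟨u, hu⟩ := h.inbox_sent m' hm'
    exact ⟨u, Or.inr hu⟩
  · obtain ⟨c, sh, u, hu⟩ := h.newView_exists
    exact ⟨c, sh, u, Or.inr hu⟩
  · rintro b u (heq | hb) hl
    · obtain ⟨heq, -⟩ := Prod.mk.inj heq
      cases heq
      exact Or.inr ⟨rfl, trivial⟩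
    · rcases h.propose_le b u hb hl with h' | h'
      · exact Or.inl h'
      · exact absurd h'.2 hp
  · rintro b u b' u' (heq | hb) (heq' | hb') hl hv
    · obtain ⟨heq, -⟩ := Prod.mk.inj heq
      obtain ⟨heq', -⟩ := Prod.mk.inj heq'
      cases heq
      cases heq'
      rfl
    · obtain ⟨heq, -⟩ := Prod.mk.inj heq
      cases heq
      exact absurd hv.symm (hnew b' u' hb' (hv ▸ hl))
    · obtain ⟨heq', -⟩ := Prod.mk.inj heq'
      cases heq'
      exact absurd hv (hnew b u hb hl)
    · exact h.propose_unique b u b' u' hb hb' hl hv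

/-- Covers both ways of leaving a view. By `newView_le`, no NewView message of `R` for view `r.view
+ 1` exists yet, which keeps these messages unique per view. -/
theorem exit (h : LocalInv M R r) (hview : r'.view = r.view + 1) (hprop : ¬ r'.proposed)
    (hinbox : r'.inbox = r.inbox) (hhigh : r'.highCert.view < r.view + 1)
    (sh : Option (Block Tx)) (t : ℝ) :
    LocalInv (insert (Msg.newView R (r.view + 1) r'.highCert sh, t) M) R r' := by
  have hN : ∀ {w c' sh' u}, (Msg.newView R w c' sh', u) ∈
      insert (Msg.newView R (r.view + 1) r'.highCert sh, t) M →
      (w = r.view + 1 ∧ c' = r'.highCert ∧ sh' = sh) ∨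
        (w ≤ r.view ∧ (Msg.newView R w c' sh', u) ∈ M) := by
    rintro w c' sh' u (heq | h')
    · obtain ⟨heq, -⟩ := Prod.mk.inj heq
      cases heq
      exact Or.inl ⟨rfl, rfl, rfl⟩
    · exact Or.inr ⟨h.newView_le _ _ _ _ h', h'⟩
  have hP : ∀ {b u}, (Msg.propose b, u) ∈
      insert (Msg.newView R (r.view + 1) r'.highCert sh, t) M → (Msg.propose b, u) ∈ M := by
    rintro b u (heq | h')
    · exact nomatch (Prod.mk.inj heq).1
    · exact h'
  refine ⟨by omega, fun m' hm' => ?_, ⟨r'.highCert, sh, t, Or.inl (by rw [hview])⟩,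
    fun w c sh u hmem => ?_, fun w c sh u c' sh' u' h1 h2 => ?_, fun c sh u hmem => ?_, by omega,
    fun hp => absurd hp hprop, fun b u hb hl => ?_,
    fun b u b' u' h1 h2 hl hv => h.propose_unique b u b' u' (hP h1) (hP h2) hl hv⟩
  · obtain ⟨u, hu⟩ := h.inbox_sent m' (hinbox ▸ hm')
    exact ⟨u, Or.inr hu⟩
  · rcases hN hmem with ⟨h1, -⟩ | ⟨h1, -⟩ <;> omega
  · rcases hN h1 with ⟨h1, h3, h4⟩ | ⟨h1, h3⟩ <;> rcases hN h2 with ⟨h2, h5, h6⟩ | ⟨h2, h5⟩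
    · exact ⟨h3.trans h5.symm, h4.trans h6.symm⟩
    · omega
    · omega
    · exact h.newView_unique _ _ _ _ _ _ _ h3 h5
  · rcases hN hmem with ⟨-, h1, -⟩ | ⟨h1, -⟩
    · exact Or.inl h1
    · omega
  · left
    rcases h.propose_le b u (hP hb) hl with h' | h' <;> omega

end LocalInv

/-- The invariant of the protocol. -/
structure Inv (s : State S Tx) : Prop where
  wellFormed : ∀ m u, (m, u) ∈ s.sent → s.WellFormed m
  time_le : ∀ m u, (m, u) ∈ s.sent → u ≤ s.now
  highCert : ∀ R, S.Correct R → s.Certified (s.loc R).highCert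
  delivered : ∀ m u, (m, u) ∈ s.sent → S.Correct m.sender → ∀ R, S.Correct R → m.AddressedTo R →
    m ∉ (s.loc R).inbox → s.now ≤ max u S.GST + S.delta
  loc : ∀ R, S.Correct R → LocalInv s.sent R (s.loc R)

namespace Inv

theorem initial : Inv (State.initial S Tx) := by
  have hsent : ∀ m u, (m, u) ∈ (State.initial S Tx).sent →
      ∃ R, m = .newView R 1 .genesis none ∧ u = 0 := by
    rintro m u ⟨R, -, heq⟩
    obtain ⟨rfl, rfl⟩ := Prod.mk.inj heq
    exact ⟨R, rfl, rfl⟩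
  refine ⟨fun m u h => ?_, fun m u h => ?_, fun R _ => Or.inl rfl, fun m u h _ R _ _ _ => ?_,
    fun R hR => ⟨Nat.one_pos, fun m hm => hm.elim, ⟨_, _, 0, R, hR, rfl⟩, fun w c sh u h => ?_,
      fun w c sh u c' sh' u' h h' => ?_, fun c sh u h => ?_, Nat.one_pos, fun h => h.elim,
      fun b u h => ?_, fun b u b' u' h => ?_⟩⟩
  · obtain ⟨R, rfl, -⟩ := hsent m u h
    exact ⟨Nat.one_pos, Or.inl rfl⟩
  · obtain ⟨R, -, rfl⟩ := hsent m u h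
    exact le_rfl
  · obtain ⟨R, -, rfl⟩ := hsent m u h
    have := le_max_left 0 S.GST
    have := S.delta_pos
    show (0 : ℝ) ≤ _
    linarith
  · obtain ⟨R, heq, -⟩ := hsent _ u h
    cases heq
    exact le_rfl
  · obtain ⟨R, heq, -⟩ := hsent _ u h
    obtain ⟨R', heq', -⟩ := hsent _ u' h'
    cases heq
    cases heq'
    exact ⟨rfl, rfl⟩
  · obtain ⟨R, heq, -⟩ := hsent _ u h
    cases heq
    exact Or.inl rfl
  · obtain ⟨R, heq, -⟩ := hsent _ u h
    exact nomatch heq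
  · obtain ⟨R, heq, -⟩ := hsent _ u h
    exact nomatch heq

variable {s s' : State S Tx} {a : Action S Tx}

theorem certified_of_forms (h : Inv s) {R : Fin S.n} (hR : S.Correct R) {b : Block Tx}
    (hb : (s.loc R).Forms b) : s.Certified b := by
  refine Or.inr (hb.2.trans (Set.ncard_le_ncard ?_ (Set.toFinite _)))
  rintro Q ⟨c, hc⟩
  obtain ⟨u, hu⟩ := (h.loc R hR).inbox_sent _ hc
  exact Or.inr ⟨_, c, u, hu⟩

/-- Certificates known to a correct leader are valid and of lower views. -/
theorem of_knows (h : Inv s) {R : Fin S.n} (hR : S.Correct R) {c : Block Tx}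
    (hc : (s.loc R).Knows c) : c.view < (s.loc R).view ∧ s.Certified c := by
  rcases hc with rfl | ⟨Q, sh, hm⟩ | hf
  · exact ⟨(h.loc R hR).high_lt, h.highCert R hR⟩
  · obtain ⟨u, hu⟩ := (h.loc R hR).inbox_sent _ hm
    exact h.wellFormed _ _ hu
  · exact ⟨by have := hf.1; omega, h.certified_of_forms hR hf⟩

theorem of_canHandle (h : Inv s) {R : Fin S.n} (hR : S.Correct R) {b : Block Tx}
    (hb : (s.loc R).CanHandle b) : b.justify.view < b.view ∧ s.Certified b.justify := by
  obtain ⟨u, hu⟩ := (h.loc R hR).inbox_sent _ hb.2.2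
  exact h.wellFormed _ _ hu

theorem afterProposal_highCert (h : Inv s) {R : Fin S.n} (hR : S.Correct R) {b : Block Tx}
    (hb : (s.loc R).CanHandle b) : ((s.loc R).afterProposal b).highCert.view < (s.loc R).view ∧
      s.Certified ((s.loc R).afterProposal b).highCert := by
  classical
  rw [ReplicaState.afterProposal_highCert]
  split_ifs
  · have := h.of_canHandle hR hb
    rwa [hb.2.1] at this
  · exact ⟨(h.loc R hR).high_lt, h.highCert R hR⟩

theorem step_wellFormed (h : Inv s) (hs : Step s a s') :
    ∀ m u, (m, u) ∈ s'.sent → s'.WellFormed m := by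
  -- Validity of certificates persists, so only the message sent in this step needs checking, and
  -- already in the old state.
  suffices hnew : ∀ m u, (m, u) ∈ s'.sent → (m, u) ∉ s.sent → s.WellFormed m by
    intro m u hm
    by_cases hm' : (m, u) ∈ s.sent
    · exact (h.wellFormed m u hm').mono hs.sent_subset
    · exact (hnew m u hm hm').mono hs.sent_subset
  intro m u hm hm'
  cases a with
  | enter R => obtain ⟨-, -, rfl⟩ := hs; exact absurd hm hm'
  | deliver R m => obtain ⟨-, -, rfl⟩ := hs; exact absurd hm hm'
  | propose R txs c =>
    obtain ⟨hR, -, hk, -, rfl⟩ := hs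
    obtain ⟨rfl, -⟩ := Prod.mk.inj (Set.eq_of_mem_insert_of_notMem hm hm')
    exact h.of_knows hR hk
  | handle R b =>
    obtain ⟨hR, hb, rfl⟩ := hs
    obtain ⟨rfl, -⟩ := Prod.mk.inj (Set.eq_of_mem_insert_of_notMem hm hm')
    obtain ⟨sh, heq, -⟩ := (s.loc R).proposalReply_eq R b
    rw [heq]
    have := h.afterProposal_highCert hR hb
    exact ⟨by omega, this.2⟩
  | timeout R =>
    obtain ⟨hR, -, rfl⟩ := hs
    obtain ⟨rfl, -⟩ := Prod.mk.inj (Set.eq_of_mem_insert_of_notMem hm hm')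
    exact ⟨Nat.lt_succ_of_lt (h.loc R hR).high_lt, h.highCert R hR⟩
  | byzantine m =>
    obtain ⟨-, hw, rfl⟩ := hs
    obtain ⟨rfl, -⟩ := Prod.mk.inj (Set.eq_of_mem_insert_of_notMem hm hm')
    exact hw
  | pass t => obtain ⟨-, -, rfl⟩ := hs; exact absurd hm hm'

theorem step_time_le (h : Inv s) (hs : Step s a s') : ∀ m u, (m, u) ∈ s'.sent → u ≤ s'.now := by
  intro m u hm
  rcases hs.sent_cases with heq | ⟨m', heq, -⟩ <;> rw [heq] at hm
  · exact (h.time_le m u hm).trans hs.now_le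
  · rcases hm with hm | hm
    · exact (Prod.mk.inj hm).2 ▸ hs.now_le
    · exact (h.time_le m u hm).trans hs.now_le

theorem step_highCert (h : Inv s) (hs : Step s a s') :
    ∀ R, S.Correct R → s'.Certified (s'.loc R).highCert := by
  intro R hR
  refine State.Certified.mono hs.sent_subset ?_
  rcases hs.loc_cases R with h' | ⟨-, h'⟩ | ⟨m, -, h'⟩ | ⟨txs, c, rfl, h'⟩ | ⟨b, rfl, h'⟩ | ⟨-, h'⟩ <;>
    rw [h']
  case inr.inr.inr.inl => exact (h.of_knows hR hs.2.2.1).2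
  case inr.inr.inr.inr.inl => exact (h.afterProposal_highCert hR hs.2.1).2
  all_goals exact h.highCert R hR

theorem _root_.HotStuff1.Step.inbox_subset (hs : Step s a s') (R : Fin S.n) :
    (s.loc R).inbox ⊆ (s'.loc R).inbox := by
  rcases hs.loc_cases R with h | ⟨-, h⟩ | ⟨m, -, h⟩ | ⟨txs, c, -, h⟩ | ⟨b, -, h⟩ | ⟨-, h⟩ <;> rw [h]
  case inr.inr.inl => exact Set.subset_insert _ _
  case inr.inr.inr.inr.inl => rw [ReplicaState.afterProposal_inbox]
  all_goals exact subset_rfl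

theorem _root_.HotStuff1.Step.now_eq_or_pass (hs : Step s a s') :
    s'.now = s.now ∨ (a = .pass s'.now ∧ s' = { s with now := s'.now } ∧ s.CanPassTo s'.now) := by
  cases a with
  | enter R => obtain ⟨-, -, rfl⟩ := hs; exact Or.inl rfl
  | deliver R m => obtain ⟨-, -, rfl⟩ := hs; exact Or.inl rfl
  | propose R txs c => obtain ⟨-, -, -, -, rfl⟩ := hs; exact Or.inl rfl
  | handle R b => obtain ⟨-, -, rfl⟩ := hs; exact Or.inl rfl
  | timeout R => obtain ⟨-, -, rfl⟩ := hs; exact Or.inl rfl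
  | byzantine m => obtain ⟨-, -, rfl⟩ := hs; exact Or.inl rfl
  | pass t => obtain ⟨-, hc, rfl⟩ := hs; exact Or.inr ⟨rfl, rfl, hc⟩

/-- A fresh message has its deadline at least `Δ` ahead, and the clock may not run past the deadline
of an undelivered one. -/
theorem step_delivered (h : Inv s) (hs : Step s a s') :
    ∀ m u, (m, u) ∈ s'.sent → S.Correct m.sender → ∀ R, S.Correct R → m.AddressedTo R →
      m ∉ (s'.loc R).inbox → s'.now ≤ max u S.GST + S.delta := by
  intro m u hm hc R hR ha hin
  rcases hs.now_eq_or_pass with hnow | ⟨-, heq, hp⟩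
  · by_cases hm' : (m, u) ∈ s.sent
    · rw [hnow]
      exact h.delivered m u hm' hc R hR ha fun hmem => hin (hs.inbox_subset R hmem)
    · rcases hs.sent_cases with heq | ⟨m', heq, -⟩ <;> rw [heq] at hm
      · exact absurd hm hm'
      · obtain ⟨-, rfl⟩ := Prod.mk.inj (Set.eq_of_mem_insert_of_notMem hm hm')
        have := le_max_left s.now S.GST
        have := S.delta_pos
        linarith
  · rw [heq] at hm hin
    exact hp.2 m u hm hc R hR ha hin

theorem step_loc (h : Inv s) (hs : Step s a s') :
    ∀ R, S.Correct R → LocalInv s'.sent R (s'.loc R) := by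
  intro R hR
  have hloc := h.loc R hR
  cases a with
  | enter Q =>
    obtain ⟨-, -, rfl⟩ := hs
    rcases eq_or_ne R Q with rfl | hne
    · simpa [State.setLoc] using hloc.enter
    · simpa [State.setLoc, hne] using hloc
  | deliver Q m =>
    obtain ⟨-, hm, rfl⟩ := hs
    rcases eq_or_ne R Q with rfl | hne
    · simpa [State.setLoc] using hloc.deliver hm
    · simpa [State.setLoc, hne] using hloc
  | propose Q txs c =>
    obtain ⟨hQ, hcan, hk, -, rfl⟩ := hs
    rcases eq_or_ne R Q with rfl | hne
    · simpa [State.setLoc, State.send] using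
        hloc.propose (t := s.now) hcan.2.1 hcan.2.2.1 txs (h.of_knows hR hk).1
    · simpa [State.setLoc, State.send, hne] using
        hloc.insert_of_sender_ne (m := .propose (.node (s.loc Q).view txs c))
          (fun heq => hne (heq.symm.trans hcan.2.1.symm)) s.now
  | handle Q b =>
    obtain ⟨hQ, hcan, rfl⟩ := hs
    obtain ⟨sh, heq, -⟩ := (s.loc Q).proposalReply_eq Q b
    rw [heq]
    rcases eq_or_ne R Q with rfl | hne
    · have := (h.afterProposal_highCert hR hcan).1
      simpa [State.setLoc, State.send] using
        hloc.exit (r' := (s.loc R).afterProposal b) (by simp) (by simp) (by simp) (by omega) sh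
          s.now
    · simpa [State.setLoc, State.send, hne] using
        hloc.insert_of_sender_ne (m := .newView Q ((s.loc Q).view + 1) _ sh) hne.symm s.now
  | timeout Q =>
    obtain ⟨hQ, hcan, rfl⟩ := hs
    rcases eq_or_ne R Q with rfl | hne
    · have := hloc.high_lt
      have hexit : LocalInv
          (insert (.newView R ((s.loc R).view + 1) (s.loc R).highCert none, s.now) s.sent) R
          (s.loc R).exitView :=
        hloc.exit (r' := (s.loc R).exitView) rfl id rfl (Nat.lt_succ_of_lt this) none s.now
      simpa [State.setLoc, State.send] using hexit
    · simpa [State.setLoc, State.send, hne] using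
        hloc.insert_of_sender_ne (m := .newView Q ((s.loc Q).view + 1) _ none) hne.symm s.now
  | byzantine m =>
    obtain ⟨hm, -, rfl⟩ := hs
    exact hloc.insert_of_sender_ne (fun heq => hR (heq ▸ hm)) s.now
  | pass t => obtain ⟨-, -, rfl⟩ := hs; exact hloc

theorem step (h : Inv s) (hs : Step s a s') : Inv s' :=
  ⟨h.step_wellFormed hs, h.step_time_le hs, h.step_highCert hs, h.step_delivered hs,
    h.step_loc hs⟩

end Inv

theorem Step.entered_or_exits {s s' : State S Tx} {a : Action S Tx} (h : Step s a s')
    {R : Fin S.n} (he : (s.loc R).entered) : (s.loc R).view < (s'.loc R).view ∨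
      ((s'.loc R).view = (s.loc R).view ∧ (s'.loc R).entered) := by
  rcases h.loc_cases R with h | ⟨-, h⟩ | ⟨m, -, h⟩ | ⟨txs, c, -, h⟩ | ⟨b, -, h⟩ | ⟨-, h⟩ <;>
    simp [h, ReplicaState.exitView, he]

/-! ### Executions: monotonicity, origins of messages, uniqueness. -/

namespace Execution

variable (E : Execution S Tx)

theorem inv (k : ℕ) : Inv (E.state k) := by
  induction k with
  | zero => rw [E.state_zero]; exact Inv.initial
  | succ k ih => exact ih.step (E.step k)

theorem now_mono : Monotone fun k => (E.state k).now :=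
  monotone_nat_of_le_succ fun k => (E.step k).now_le

theorem sent_mono : Monotone fun k => (E.state k).sent :=
  monotone_nat_of_le_succ fun k => (E.step k).sent_subset

theorem view_mono (R : Fin S.n) : Monotone fun k => ((E.state k).loc R).view :=
  monotone_nat_of_le_succ fun k => (E.step k).view_le R

theorem highCert_view_mono (R : Fin S.n) : Monotone fun k => ((E.state k).loc R).highCert.view :=
  monotone_nat_of_le_succ fun k => (E.step k).highCert_view_le R

theorem mem_globalLedger_of_le {R : Fin S.n} {b : Block Tx} {j k : ℕ} (hjk : j ≤ k)
    (h : b ∈ ((E.state j).loc R).globalLedger) : b ∈ ((E.state k).loc R).globalLedger := by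
  induction k, hjk using Nat.le_induction with
  | base => exact h
  | succ k _ ih => exact (E.step k).globalLedger_subset R ih

variable {E}

theorem lt_of_now_lt {i k : ℕ} (h : (E.state i).now < (E.state k).now) : i < k :=
  lt_of_not_ge fun hki => (E.now_mono hki).not_gt h

theorem step_handle {k : ℕ} {R : Fin S.n} {b : Block Tx} (h : E.act k = .handle R b) :
    S.Correct R ∧ ((E.state k).loc R).CanHandle b ∧
      (E.state (k + 1)).loc R = ((E.state k).loc R).afterProposal b := by
  have hs := E.step k
  rw [h] at hs
  obtain ⟨h1, h2, h3⟩ := hs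
  exact ⟨h1, h2, by simp [h3, State.setLoc, State.send]⟩

theorem sent_of_handle {k : ℕ} {R : Fin S.n} {b : Block Tx} (h : E.act k = .handle R b) :
    ∃ u, (Msg.propose b, u) ∈ (E.state k).sent := by
  obtain ⟨hR, hb, -⟩ := step_handle h
  exact ((E.inv k).loc R hR).inbox_sent _ hb.2.2

/-- Replicas start in view `1` and advance one view at a time, only by handling a proposal or by
timing out, so no positive view is skipped. -/
theorem exists_exit_step {R : Fin S.n} {w k : ℕ} (hw : 0 < w)
    (h : w < ((E.state k).loc R).view) : ∃ j < k, ((E.state j).loc R).view = w ∧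
      ((∃ b, E.act j = .handle R b) ∨ E.act j = .timeout R) := by
  induction k with
  | zero =>
    rw [E.state_zero] at h
    exact absurd h (by simp only [State.initial]; omega)
  | succ k ih =>
    by_cases hk : w < ((E.state k).loc R).view
    · obtain ⟨j, hj, h'⟩ := ih hk
      exact ⟨j, by omega, h'⟩
    · refine ⟨k, by omega, ?_⟩
      rcases (E.step k).loc_cases R with h' | ⟨-, h'⟩ | ⟨m, -, h'⟩ | ⟨txs, c, -, h'⟩ | ⟨b, ha, h'⟩ |
        ⟨ha, h'⟩ <;> rw [h'] at h
      case inr.inr.inr.inr.inl =>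
        rw [ReplicaState.afterProposal_view] at h
        exact ⟨by omega, Or.inl ⟨b, ha⟩⟩
      case inr.inr.inr.inr.inr =>
        simp only [ReplicaState.exitView] at h
        exact ⟨by omega, Or.inr ha⟩
      all_goals exact absurd h hk

/-- A proposal signed by a correct leader stems from a step in which it proposed. -/
theorem exists_propose_step {k : ℕ} {b : Block Tx} {u : ℝ}
    (h : (Msg.propose b, u) ∈ (E.state k).sent) (hL : S.Correct (S.leader b.view)) :
    ∃ j txs c, E.act j = .propose (S.leader b.view) txs c ∧
      ((E.state j).loc (S.leader b.view)).view = b.view ∧ b = .node b.view txs c := by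
  induction k with
  | zero =>
    rw [E.state_zero] at h
    obtain ⟨R, -, heq⟩ := h
    exact nomatch (Prod.mk.inj heq).1
  | succ k ih =>
    rcases (E.step k).sent_cases with heq | ⟨m, heq, hm⟩ <;> rw [heq] at h
    · exact ih h
    · rcases h with h | h
      · obtain ⟨rfl, -⟩ := Prod.mk.inj h
        rcases hm with ⟨R, txs, c, ha, hm⟩ | ⟨R, b', ha, hm⟩ | ⟨R, ha, hm⟩ | ⟨ha, hm⟩
        · have hs := E.step k
          rw [ha] at hs
          have hR : R = S.leader b.view := by
            cases hm
            exact hs.2.1.2.1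
          refine ⟨k, txs, c, hR ▸ ha, ?_, ?_⟩ <;> cases hm
          · exact congrArg (fun Q => ((E.state k).loc Q).view) hR.symm
          · rfl
        · obtain ⟨sh, heq, -⟩ := ((E.state k).loc R).proposalReply_eq R b'
          exact nomatch hm.trans heq
        · exact nomatch hm
        · exact absurd hm hL
      · exact ih h

/-- A share of a correct replica stems from a step in which it voted. -/
theorem exists_vote_step {k w : ℕ} {R : Fin S.n} {c b : Block Tx} {u : ℝ}
    (h : (Msg.newView R w c (some b), u) ∈ (E.state k).sent) (hR : S.Correct R) :
    ∃ j, E.act j = .handle R b ∧ ((E.state j).loc R).Votes b := by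
  induction k with
  | zero =>
    rw [E.state_zero] at h
    obtain ⟨R, -, heq⟩ := h
    exact nomatch (Prod.mk.inj heq).1
  | succ k ih =>
    rcases (E.step k).sent_cases with heq | ⟨m, heq, hm⟩ <;> rw [heq] at h
    · exact ih h
    · rcases h with h | h
      · obtain ⟨rfl, -⟩ := Prod.mk.inj h
        rcases hm with ⟨Q, txs, c, ha, hm⟩ | ⟨Q, b', ha, hm⟩ | ⟨Q, ha, hm⟩ | ⟨ha, hm⟩
        · exact nomatch hm
        · obtain ⟨sh, heq, hsh⟩ := ((E.state k).loc Q).proposalReply_eq Q b'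
          have heq' := hm.trans heq
          cases heq'
          obtain ⟨rfl, hv⟩ := hsh b rfl
          exact ⟨k, ha, hv⟩
        · exact nomatch hm
        · exact absurd hm hR
      · exact ih h

theorem propose_unique {k k' : ℕ} {b b' : Block Tx} {u u' : ℝ}
    (h : (Msg.propose b, u) ∈ (E.state k).sent) (h' : (Msg.propose b', u') ∈ (E.state k').sent)
    (hL : S.Correct (S.leader b.view)) (hv : b.view = b'.view) : b = b' :=
  ((E.inv (max k k')).loc _ hL).propose_unique _ _ _ _ (E.sent_mono (le_max_left k k') h)
    (E.sent_mono (le_max_right k k') h') rfl hv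

theorem newView_unique {k k' w : ℕ} {R : Fin S.n} {c c' : Block Tx} {sh sh' : Option (Block Tx)}
    {u u' : ℝ} (hR : S.Correct R) (h : (Msg.newView R w c sh, u) ∈ (E.state k).sent)
    (h' : (Msg.newView R w c' sh', u') ∈ (E.state k').sent) : c = c' ∧ sh = sh' :=
  ((E.inv (max k k')).loc _ hR).newView_unique _ _ _ _ _ _ _ (E.sent_mono (le_max_left k k') h)
    (E.sent_mono (le_max_right k k') h')

/-- In a view with a correct leader only the proposal of the leader can be certified. -/
theorem eq_of_certified {k k' : ℕ} {b B : Block Tx} {u : ℝ}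
    (hB : (Msg.propose B, u) ∈ (E.state k).sent) (hL : S.Correct (S.leader B.view))
    (hb : (E.state k').Certified b) (hv : b.view = B.view) (hpos : 0 < B.view) : b = B := by
  obtain ⟨R, hR, w, c, t, hsh⟩ := hb.exists_share (hv ▸ hpos)
  obtain ⟨j, hj, -⟩ := exists_vote_step hsh hR
  obtain ⟨u', hu'⟩ := sent_of_handle hj
  exact (propose_unique hB hu' hL hv.symm).symm

theorem view_entered_of_entersAt {i k w : ℕ} {R : Fin S.n} (h : E.EntersAt i R w) (hik : i < k) :
    w < ((E.state k).loc R).view ∨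
      (((E.state k).loc R).view = w ∧ ((E.state k).loc R).entered) := by
  induction k, hik using Nat.le_induction with
  | base =>
    have hs := E.step i
    rw [h.1] at hs
    right
    rw [hs.2.2]
    simpa [State.setLoc] using h.2
  | succ k _ ih =>
    rcases ih with ih | ⟨hv, he⟩
    · exact Or.inl (ih.trans_le ((E.step k).view_le R))
    · rcases (E.step k).entered_or_exits he with h' | h'
      · exact Or.inl (hv ▸ h')
      · exact Or.inr ⟨h'.1.trans hv, h'.2⟩

/-- The step in which time passes beyond `T`. -/
theorem exists_pass_step {i : ℕ} {T : ℝ} (hi : (E.state i).now ≤ T) :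
    ∃ k t, i ≤ k ∧ (E.state k).now ≤ T ∧ T < t ∧ E.act k = .pass t ∧ (E.state k).CanPassTo t ∧
      E.state (k + 1) = { E.state k with now := t } := by
  classical
  have hex := E.time_diverges T
  obtain ⟨k, hk⟩ : ∃ k, Nat.find hex = k + 1 := by
    refine Nat.exists_eq_succ_of_ne_zero fun h0 => ?_
    have h1 := Nat.find_spec hex
    rw [h0] at h1
    exact (h1.trans_le (E.now_mono (Nat.zero_le i))).not_ge hi
  have hlt : T < (E.state (k + 1)).now := hk ▸ Nat.find_spec hex
  have hle : (E.state k).now ≤ T := not_lt.1 (Nat.find_min hex (by omega))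
  have hik : i < k + 1 := lt_of_now_lt (hi.trans_lt hlt)
  rcases (E.step k).now_eq_or_pass with h | ⟨h1, h2, h3⟩
  · exact absurd (h ▸ hlt) hle.not_gt
  · exact ⟨k, _, by omega, hle, hlt, h1, h3, h2⟩

theorem EntersAt.lt_of_pass {i k w : ℕ} {R : Fin S.n} {t : ℝ} (h : E.EntersAt i R w) (hik : i ≤ k)
    (hk : E.act k = .pass t) : i < k := by
  refine lt_of_le_of_ne hik ?_
  rintro rfl
  exact nomatch h.1.symm.trans hk

/-! ### Synchronized views with correct leaders. -/

section Synchronized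

variable {vs w : ℕ} (h_sync : E.SynchronizedFrom vs) (hw : vs ≤ w)
include h_sync hw

/-- Even if `vs = 0`, synchronization makes some correct replica enter `w`, and views of replicas
are positive. This keeps genesis apart from the blocks of view `w`. -/
theorem SynchronizedFrom.view_pos : 0 < w := by
  obtain ⟨R, -, hR⟩ := S.exists_correct_mem_of_quorum S.card_correct
  obtain ⟨k, hk, -⟩ := (h_sync w hw).1 R hR
  rw [← hk.2]
  exact ((E.inv k).loc R hR).view_pos

/-- The leader's timer runs for more than `6Δ`, and no correct replica times out more than `2Δ`
before it expires. What remains, `4Δ`, covers entering (`2Δ`), NewView messages (`Δ`) and the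
proposal (`Δ`). -/
theorem SynchronizedFrom.lt_now_of_timeout (h_tau : 6 * S.delta < S.tau)
    (hL : S.Correct (S.leader w)) {j : ℕ} {R : Fin S.n}
    (hj : E.act j = .timeout R) (hv : ((E.state j).loc R).view = w) :
    S.start (S.leader w) w + 4 * S.delta < (E.state j).now := by
  have hs := E.step j
  rw [hj] at hs
  have h1 := (h_sync w hw).2.2 j (S.leader w) R hL hs.1 ⟨hj, hv⟩
  have h2 := (h_sync w hw).2.1 (S.leader w) hL
  linarith

/-- When its share timer fires, a correct leader has received the NewView messages of all correct
replicas. -/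
theorem SynchronizedFrom.newView_received (hL : S.Correct (S.leader w)) {R : Fin S.n}
    (hR : S.Correct R) {k : ℕ}
    (hk : S.start (S.leader w) w + 3 * S.delta ≤ (E.state k).now) :
    ∃ c sh, Msg.newView R w c sh ∈ ((E.state k).loc (S.leader w)).inbox := by
  obtain ⟨i, hi, hG, hlt⟩ := (h_sync w hw).1 R hR
  obtain ⟨c, sh, u, hu⟩ := ((E.inv i).loc R hR).newView_exists
  rw [hi.2] at hu
  have hui := (E.inv i).time_le _ _ hu
  have hlt' := hlt _ hL
  have hd := S.delta_pos
  have hik : i < k := lt_of_now_lt (by linarith)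
  refine ⟨c, sh, ?_⟩
  by_contra hin
  -- The message was sent no later than `R` entered, and `GST` is no later either. So its deadline
  -- lies before `start + 3Δ`.
  have h1 := (E.inv k).delivered _ u (E.sent_mono hik.le hu) hR _ hL rfl hin
  have h2 : max u S.GST ≤ (E.state i).now := max_le hui hG
  linarith

/-- When the clock passes `start + 3Δ`, a leader still in `w` must have proposed, since otherwise
proposing would be enabled. If it has left `w`, it did so by handling a proposal, as timeouts come
later. -/
theorem SynchronizedFrom.leader_proposes (h_tau : 6 * S.delta < S.tau)
    (hL : S.Correct (S.leader w)) : ∃ k b u, (Msg.propose b, u) ∈ (E.state k).sent ∧ b.view = w ∧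
      (E.state k).now ≤ S.start (S.leader w) w + 3 * S.delta := by
  obtain ⟨i, hi, hG, hlt⟩ := (h_sync w hw).1 _ hL
  have hlt' := hlt _ hL
  have hd := S.delta_pos
  obtain ⟨k, t, hik, hkT, hTt, hact, hpass, hstate⟩ :=
    E.exists_pass_step (i := i) (T := S.start (S.leader w) w + 3 * S.delta) (by linarith)
  rcases view_entered_of_entersAt hi (hi.lt_of_pass hik hact) with hv | ⟨hv, he⟩
  · obtain ⟨j, hjk, hjv, ⟨b, hb⟩ | hto⟩ := exists_exit_step (h_sync.view_pos hw) hv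
    · obtain ⟨u, hu⟩ := sent_of_handle hb
      exact ⟨j, b, u, hu, (step_handle hb).2.1.2.1.trans hjv, (E.now_mono hjk.le).trans hkT⟩
    · have h1 := h_sync.lt_now_of_timeout hw h_tau hL hto hjv
      have h2 : (E.state j).now ≤ (E.state k).now := E.now_mono hjk.le
      linarith
  · by_cases hp : ((E.state k).loc (S.leader w)).proposed
    · obtain ⟨b, u, hb, hbv, -⟩ := ((E.inv k).loc _ hL).proposed_sent hp
      exact ⟨k, b, u, hb, hbv.trans hv, hkT⟩
    · refine absurd ?_ (hpass.1 _ hL (max (E.state k).now _) (le_max_left _ _)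
        (max_lt (hkT.trans_lt hTt) hTt)).1
      refine ⟨he, by rw [hv], hp, S.card_correct.trans (Set.ncard_le_ncard ?_ (Set.toFinite _)),
        Or.inr (Or.inr (by rw [hv]; exact le_max_right _ _))⟩
      intro R hR
      -- The deadline argument needs a state at or after `start + 3Δ`. Step `k` only moves the
      -- clock, so the inbox after it is the one before it.
      obtain ⟨c, sh, hm⟩ := h_sync.newView_received hw hL hR (k := k + 1)
        (by rw [hstate]; exact hTt.le)
      rw [hstate] at hm
      exact ⟨c, sh, by rw [hv]; exact hm⟩

/-- A proposal sent by `start + 3Δ` arrives by `start + 4Δ`, before any timeout. Time cannot pass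
beyond that while `R` is still in `w` with a proposal left to handle. -/
theorem SynchronizedFrom.handles (h_tau : 6 * S.delta < S.tau) (hL : S.Correct (S.leader w))
    {R : Fin S.n} (hR : S.Correct R) :
    ∃ j b, E.act j = .handle R b ∧ ((E.state j).loc R).view = w := by
  obtain ⟨k₀, b, u, hb, hbv, hk₀⟩ := h_sync.leader_proposes hw h_tau hL
  obtain ⟨i₀, -, hG, hlt₀⟩ := (h_sync w hw).1 _ hL
  obtain ⟨i, hi, -, hlt⟩ := (h_sync w hw).1 _ hR
  have hlt' := hlt _ hL
  have hlt₀' := hlt₀ _ hL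
  have hd := S.delta_pos
  obtain ⟨k, t, hik, hkT, hTt, hact, hpass, hstate⟩ :=
    E.exists_pass_step (i := i) (T := S.start (S.leader w) w + 4 * S.delta) (by linarith)
  rcases view_entered_of_entersAt hi (hi.lt_of_pass hik hact) with hv | ⟨hv, he⟩
  · obtain ⟨j, hjk, hjv, ⟨b, hb⟩ | hto⟩ := exists_exit_step (h_sync.view_pos hw) hv
    · exact ⟨j, b, hb, hjv⟩
    · have h1 := h_sync.lt_now_of_timeout hw h_tau hL hto hjv
      have h2 : (E.state j).now ≤ (E.state k).now := E.now_mono hjk.le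
      linarith
  · have hnow : (E.state (k + 1)).now = t := by rw [hstate]
    have hin : Msg.propose b ∈ ((E.state (k + 1)).loc R).inbox := by
      by_contra hin
      have hsent : (Msg.propose b, u) ∈ (E.state (k + 1)).sent :=
        E.sent_mono (lt_of_now_lt (E := E) (by linarith)).le hb
      have h1 := (E.inv (k + 1)).delivered _ u hsent
        (by simpa [Msg.sender, hbv] using hL) R hR trivial hin
      have h2 : max u S.GST ≤ S.start (S.leader w) w + 3 * S.delta :=
        max_le (((E.inv k₀).time_le _ _ hb).trans hk₀) (by linarith)
      linarith
    rw [hstate] at hin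
    exact absurd ⟨he, hbv.trans hv.symm, hin⟩
      ((hpass.1 R hR _ le_rfl (hkT.trans_lt hTt)).2.1 b)

/-- When a correct leader proposes, it has formed a certificate of the preceding view, or received
the NewView messages of all correct replicas. -/
theorem SynchronizedFrom.forms_or_received (hL : S.Correct (S.leader w)) {p : ℕ} {txs : List Tx}
    {c : Block Tx} (hp : E.act p = .propose (S.leader w) txs c)
    (hv : ((E.state p).loc (S.leader w)).view = w) :
    (∃ b, ((E.state p).loc (S.leader w)).Forms b) ∨
      ∀ R, S.Correct R → ∃ c sh, Msg.newView R w c sh ∈ ((E.state p).loc (S.leader w)).inbox := by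
  have hs := E.step p
  rw [hp] at hs
  obtain ⟨-, ⟨-, -, -, -, h | h | h⟩, -⟩ := hs
  · exact Or.inl h
  · right
    intro R _
    have huniv : ((E.state p).loc (S.leader w)).newViewSenders = Set.univ :=
      Set.eq_of_subset_of_ncard_le (Set.subset_univ _) (by simpa [Set.ncard_univ] using h)
    have hR : R ∈ ((E.state p).loc (S.leader w)).newViewSenders := huniv ▸ Set.mem_univ R
    obtain ⟨c, sh, hm⟩ := hR
    rw [hv] at hm
    exact ⟨c, sh, hm⟩
  · rw [hv] at h
    exact Or.inr fun R hR => h_sync.newView_received hw hL hR h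

/-- The certificate in the proposal of a correct leader is at least as high as those that correct
replicas carry into the view. -/
theorem SynchronizedFrom.newView_view_le (hL : S.Correct (S.leader w)) {p k : ℕ} {txs : List Tx}
    {c c' : Block Tx} {sh : Option (Block Tx)} {u : ℝ} {R : Fin S.n} (hR : S.Correct R)
    (hp : E.act p = .propose (S.leader w) txs c)
    (hv : ((E.state p).loc (S.leader w)).view = w)
    (hm : (Msg.newView R w c' sh, u) ∈ (E.state k).sent) : c'.view ≤ c.view := by
  have hs := E.step p
  rw [hp] at hs
  have hmax := hs.2.2.2.1
  rcases h_sync.forms_or_received hw hL hp hv with ⟨b, hb⟩ | hall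
  · have h1 := hmax b (Or.inr (Or.inr hb))
    have h2 := hb.1
    have h3 := ((E.inv k).wellFormed _ _ hm).1
    omega
  · obtain ⟨c₁, sh₁, h1⟩ := hall R hR
    obtain ⟨u₁, hu₁⟩ := ((E.inv p).loc _ hL).inbox_sent _ h1
    rw [(newView_unique hR hm hu₁).1]
    exact hmax c₁ (Or.inr (Or.inl ⟨R, sh₁, hv.symm ▸ h1⟩))

/-- In a synchronized view, all correct replicas vote for the proposal of a correct leader. -/
theorem SynchronizedFrom.all_vote (h_tau : 6 * S.delta < S.tau) (hL : S.Correct (S.leader w))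
    {k : ℕ} {B : Block Tx} {u : ℝ} (hB : (Msg.propose B, u) ∈ (E.state k).sent)
    (hBv : B.view = w) {R : Fin S.n} (hR : S.Correct R) :
    ∃ j, E.act j = .handle R B ∧ ((E.state j).loc R).view = w ∧ ((E.state j).loc R).Votes B := by
  obtain ⟨j, b, hj, hjv⟩ := h_sync.handles hw h_tau hL hR
  obtain ⟨ub, hub⟩ := sent_of_handle hj
  have hbv : b.view = w := (step_handle hj).2.1.2.1.trans hjv
  have hL' : S.Correct (S.leader B.view) := hBv ▸ hL
  obtain rfl := propose_unique hB hub hL' (hBv.trans hbv.symm)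
  refine ⟨j, hj, hjv, ?_⟩
  obtain ⟨c, sh, u', hu'⟩ := ((E.inv j).loc R hR).newView_exists
  -- Either the highest certificate of `R` is still the one in its NewView message for `w`, or `R`
  -- is the leader and it is the one carried by `B` itself.
  rcases ((E.inv j).loc R hR).newView_high c sh u' hu' with rfl | hprop
  · obtain ⟨p, txs, c, hp, hpv, hBeq⟩ := exists_propose_step hB hL'
    have hj_eq : B.justify = c := by rw [hBeq]; rfl
    rw [hBv] at hp hpv
    rw [hjv] at hu'
    show _ ≤ B.justify.view
    rw [hj_eq]
    exact h_sync.newView_view_le hw hL hR hp hpv hu'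
  · obtain ⟨b', u', hb', hbv', hjust, -⟩ := ((E.inv j).loc R hR).proposed_sent hprop
    obtain rfl := propose_unique hB hb' hL' (by omega)
    exact (congrArg Block.view hjust).ge

/-- The proposal of the second of two consecutive correct leaders carries the certificate of the
proposal of the first one. -/
theorem SynchronizedFrom.justify_eq (h_tau : 6 * S.delta < S.tau) (hL : S.Correct (S.leader w))
    (hL' : S.Correct (S.leader (w + 1))) {k k' : ℕ} {B B' : Block Tx} {u u' : ℝ}
    (hB : (Msg.propose B, u) ∈ (E.state k).sent) (hBv : B.view = w)
    (hB' : (Msg.propose B', u') ∈ (E.state k').sent) (hBv' : B'.view = w + 1) :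
    B'.justify = B := by
  have hLB : S.Correct (S.leader B.view) := hBv ▸ hL
  obtain ⟨p, txs, c, hp, hpv, hBeq⟩ := exists_propose_step hB' (hBv' ▸ hL')
  have hj_eq : B'.justify = c := by rw [hBeq]; rfl
  rw [hBv'] at hp hpv
  have hs := E.step p
  rw [hp] at hs
  obtain ⟨-, -, hknows, hmax, -⟩ := hs
  have hpos := h_sync.view_pos hw
  have hforms : ((E.state p).loc (S.leader (w + 1))).Forms B := by
    -- A certificate formed for view `w` can only be that of `B`. Otherwise the messages of all
    -- correct replicas are there, with their `n - f` or more shares on `B`.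
    rcases h_sync.forms_or_received (by omega : vs ≤ w + 1) hL' hp hpv with ⟨b, hb⟩ | hall
    · have hbv := hb.1
      rwa [eq_of_certified hB hLB ((E.inv p).certified_of_forms hL' hb) (by omega)
        (by omega)] at hb
    · refine ⟨by omega, S.card_correct.trans (Set.ncard_le_ncard ?_ (Set.toFinite _))⟩
      intro R hR
      obtain ⟨c₁, sh₁, h1⟩ := hall R hR
      obtain ⟨u₁, hu₁⟩ := ((E.inv p).loc _ hL').inbox_sent _ h1
      obtain ⟨j, hj, hjv, hvote⟩ := h_sync.all_vote hw h_tau hL hB hBv hR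
      have hsj := E.step j
      rw [hj] at hsj
      have hsent : (Msg.newView R (w + 1) B.justify (some B), (E.state j).now) ∈
          (E.state (j + 1)).sent := by
        rw [hsj.2.2]
        left
        rw [ReplicaState.proposalReply, if_pos hvote, hjv]
        rfl
      obtain ⟨rfl, rfl⟩ := newView_unique hR hu₁ hsent
      refine ⟨B.justify, ?_⟩
      rw [hpv]
      exact h1
  have h1 := hmax B (Or.inr (Or.inr hforms))
  have h2 := (E.inv p).of_knows hL' hknows
  rw [hj_eq]
  -- The adopted certificate has view at least `w`, by maximality, and below `w + 1`. Only `B` can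
  -- be certified in view `w`.
  exact eq_of_certified hB hLB h2.2 (by omega) (by omega)

/-- All certificates of higher views extend the certificate of the proposal of the first of two
consecutive correct leaders. -/
theorem SynchronizedFrom.includes_of_certified (h_tau : 6 * S.delta < S.tau)
    (hL : S.Correct (S.leader w)) (hL' : S.Correct (S.leader (w + 1))) {k : ℕ} {B : Block Tx}
    {u : ℝ} (hB : (Msg.propose B, u) ∈ (E.state k).sent) (hBv : B.view = w) {k' : ℕ}
    {b : Block Tx} (hb : (E.state k').Certified b) (hbv : w < b.view) : b.Includes B := by
  obtain ⟨k₁, B', u₁, hB', hBv', -⟩ :=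
    h_sync.leader_proposes (by omega : vs ≤ w + 1) h_tau hL'
  have hjust := h_sync.justify_eq hw h_tau hL hL' hB hBv hB' hBv'
  have hpos := h_sync.view_pos hw
  induction hn : b.view using Nat.strong_induction_on generalizing b k' with
  | _ n ih =>
    subst hn
    by_cases hsucc : b.view = w + 1
    · obtain rfl := eq_of_certified hB' (hBv' ▸ hL') hb (hsucc.trans hBv'.symm) (by omega)
      exact hjust ▸ Block.includes_justify (by omega)
    · obtain ⟨R, hR, _, _, _, hsh⟩ := hb.exists_share (by omega)
      obtain ⟨j, hj, hvote⟩ := exists_vote_step hsh hR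
      obtain ⟨-, hcan, -⟩ := step_handle hj
      have hjb := (E.inv j).of_canHandle hR hcan
      have hjv := hcan.2.1
      -- The correct voter `R` for `b` voted earlier for `B'`, adopting the certificate of `B`. Its
      -- highest certificate never drops in view, so `b` carries one of view at least `w`.
      obtain ⟨i, hi, hiv, hivote⟩ :=
        h_sync.all_vote (by omega : vs ≤ w + 1) h_tau hL' hB' hBv' hR
      have hij : i < j := lt_of_not_ge fun hji => by
        have h1 : ((E.state j).loc R).view ≤ ((E.state i).loc R).view := E.view_mono R hji
        omega
      have hhigh : ((E.state (i + 1)).loc R).highCert = B := by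
        rw [(step_handle hi).2.2, ReplicaState.afterProposal_highCert, if_pos hivote, hjust]
      have hmono : ((E.state (i + 1)).loc R).highCert.view ≤ ((E.state j).loc R).highCert.view :=
        E.highCert_view_mono R hij
      rw [hhigh] at hmono
      have hle : B.view ≤ b.justify.view := hmono.trans hvote
      rcases hle.eq_or_lt with heq | hlt
      · rw [← eq_of_certified hB (hBv ▸ hL) hjb.2 heq.symm (by omega)]
        exact Block.includes_justify (by omega)
      · exact (ih _ hjb.1 hjb.2 (by omega) rfl).of_justify

/-- The proposal of the first of three consecutive correct leaders is committed with all blocks below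
it. -/
theorem SynchronizedFrom.commits (h_tau : 6 * S.delta < S.tau) (hL : S.Correct (S.leader w))
    (hL₁ : S.Correct (S.leader (w + 1))) (hL₂ : S.Correct (S.leader (w + 2))) :
    ∃ C, C.view = w ∧ (∃ k, (E.state k).Certified C) ∧
      ∀ b ∈ C.chain, ∀ R, S.Correct R → E.EventuallyCommits R b := by
  obtain ⟨k₀, C, u₀, hC, hCv, -⟩ := h_sync.leader_proposes hw h_tau hL
  obtain ⟨k₁, C₁, u₁, hC₁, hCv₁, -⟩ :=
    h_sync.leader_proposes (by omega : vs ≤ w + 1) h_tau hL₁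
  obtain ⟨k₂, C₂, u₂, hC₂, hCv₂, -⟩ :=
    h_sync.leader_proposes (by omega : vs ≤ w + 2) h_tau hL₂
  have hj₁ := h_sync.justify_eq hw h_tau hL hL₁ hC hCv hC₁ hCv₁
  have hj₂ := h_sync.justify_eq (by omega : vs ≤ w + 1) h_tau hL₁ hL₂ hC₁ hCv₁ hC₂ hCv₂
  refine ⟨C, hCv, ⟨k₁, hj₁ ▸ ((E.inv k₁).wellFormed _ _ hC₁).2⟩, fun b hb R hR => ?_⟩
  obtain ⟨j, hj, -, -⟩ := h_sync.all_vote (by omega : vs ≤ w + 2) h_tau hL₂ hC₂ hCv₂ hR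
  refine ⟨j + 1, fun k hk => E.mem_globalLedger_of_le hk ?_⟩
  rw [(step_handle hj).2.2, ReplicaState.afterProposal_globalLedger]
  -- `C₂` carries the certificate of `C₁`, and `C₁` that of `C`, in consecutive views. This is the
  -- commit rule for `C`.
  refine ReplicaState.mem_commit _ ?_ ?_ <;> rw [hj₂, hj₁]
  · omega
  · exact hb

end Synchronized

theorem Proposes.sent {R : Fin S.n} {v : ℕ} {b : Block Tx} (h : E.Proposes R v b) :
    b.view = v ∧ ∃ k u, (Msg.propose b, u) ∈ (E.state k).sent := by
  obtain ⟨k, txs, c, hact, rfl, rfl⟩ := h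
  have hs := E.step k
  rw [hact] at hs
  refine ⟨rfl, k + 1, (E.state k).now, ?_⟩
  rw [hs.2.2.2.2]
  exact Or.inl rfl

end Execution

end HotStuff1

theorem mainTheorem4 {Tx : Type*} (S : HotStuff1.System) (h_tau : 6 * S.delta < S.tau)
    (E : HotStuff1.Execution S Tx) (vs : ℕ) (h_sync : E.SynchronizedFrom vs)
    (v : ℕ) (hv : vs ≤ v)
    (h_leader : S.Correct (S.leader v)) (h_leader_succ : S.Correct (S.leader (v + 1)))
    (B : HotStuff1.Block Tx) (hB : E.Proposes (S.leader v) v B) :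
    (∀ R, S.Correct R → E.EventuallyCommits R B) ∧ ¬ E.ConflictingCertificateAbove v B := by
  obtain ⟨hBv, k, u, hsent⟩ := hB.sent
  constructor
  -- The three leaders come strictly after `v`, so the certified block `C` of view `w` includes `B`,
  -- and `B` is committed with it.
  · obtain ⟨w, hvw, h0, h1, h2⟩ := S.exists_three_correct_leaders v
    obtain ⟨C, hCv, ⟨k', hC⟩, hcommit⟩ := h_sync.commits (by omega : vs ≤ w) h_tau h0 h1 h2
    exact hcommit B (h_sync.includes_of_certified hv h_tau h_leader h_leader_succ hsent hBv hC
      (by omega)).mem_chain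
  · rintro ⟨k', b, hb, hbv, hconf, -⟩
    exact hconf ⟨by omega, h_sync.includes_of_certified hv h_tau h_leader h_leader_succ hsent hBv
      hb hbv⟩
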